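/- A bipartite system with finite input sets $\mathcal X,\mathcal Y$ and finite non-empty output sets $\mathcal A,\mathcal B$ is a conditional probability distribution $P(ab|xy)$ ($a\in\mathcal A$, $b\in\mathcal B$, $x\in\mathcal X$, $y\in\mathcal Y$). It is non-signaling if $\sum_b P(ab|xy)=\sum_b P(ab|xy')$ for all $a,x,y,y'$ and $\sum_a P(ab|xy)=\sum_a P(ab|x'y)$ for all $b,x,x',y$. The Popescu–Rohrlich non-local box (NLB) is the system with all inputs and outputs in $\{0,1\}$ and $P_{\mathrm{NLB}}(ab|xy)=1/2$ if $xy\equiv a+b \pmod 2$, and $0$ otherwise. A protocol with $n$ NLBs is the following: the two parties share a random variable $r$ with finitely many values, distributed independently of the inputs. Without communicating, they use their ends of $n$ independent NLBs, each once and in the same order; a party may choose its input to each box depending on its own input ($x$ or $y$), on $r$, and on the outputs it received from the earlier boxes, and finally computes its output ($a$ or $b$) from its own input, $r$ and all box outputs it received. Let $P_{\mathrm{SIM}}(ab|xy)$ be the resulting system. **Theorem.** For every bipartite non-signaling system $P$ with finite input sets and finite non-empty output sets, and every $\varepsilon>0$, there are an $n\in\mathbb N$ and a protocol with $n$ NLBs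 such that $$\tfrac12\sum_{a,b}\bigl|P_{\mathrm{SIM}}(ab|xy)-P(ab|xy)\bigr|\le\varepsilon\qquad\text{for all }x\in\mathcal X,\ y\in\mathcal Y.$$ -/

import Mathlib

open scoped BigOperators

/-- A bipartite input-output system, i.e. a conditional probability distribution `P(ab|xy)`:
`prob x y a b` is the probability that the left party obtains `a` and the right party obtains `b`
when their inputs are `x` and `y`. -/
structure BipartiteSystem (X Y A B : Type*) [Fintype A] [Fintype B] where
  prob : X → Y → A → B → ℝ
  prob_nonneg : ∀ x y a b, 0 ≤ prob x y a b
  sum_prob : ∀ x y, ∑ a, ∑ b, prob x y a b = 1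

namespace BipartiteSystem

variable {X Y A B : Type*} [Fintype A] [Fintype B]

/-- The marginal `P(a|x)` does not depend on `y`, and the marginal `P(b|y)` does not depend
on `x`. -/
def NonSignaling (S : BipartiteSystem X Y A B) : Prop :=
  (∀ a x y y', ∑ b, S.prob x y a b = ∑ b, S.prob x y' a b) ∧
  (∀ b x x' y, ∑ a, S.prob x y a b = ∑ a, S.prob x' y a b)

/-- Total variation distance between the output distributions of two systems on the inputs
`x`, `y`. -/
noncomputable def tvDist (S T : BipartiteSystem X Y A B) (x : X) (y : Y) : ℝ :=
  (1 / 2) * ∑ a, ∑ b, |S.prob x y a b - T.prob x y a b|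

end BipartiteSystem

/-- The Popescu-Rohrlich non-local box, with `{0,1}` as `ZMod 2`: probability `1/2` if
`xy = a + b` modulo 2, and `0` otherwise. -/
noncomputable def nonLocalBox : BipartiteSystem (ZMod 2) (ZMod 2) (ZMod 2) (ZMod 2) where
  prob x y a b := if x * y = a + b then 1 / 2 else 0
  prob_nonneg x y a b := by split_ifs <;> norm_num
  sum_prob x y := by
    have h : ∀ a : ZMod 2, ∑ b : ZMod 2, (if x * y = a + b then (1 / 2 : ℝ) else 0) = 1 / 2 := by
      intro a
      have e : ∀ b : ZMod 2, (x * y = a + b) ↔ (x * y - a = b) := fun b => by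
        rw [sub_eq_iff_eq_add']
      simp only [e, Finset.sum_ite_eq, Finset.mem_univ, if_true]
    simp only [h, Finset.sum_const, Finset.card_univ, ZMod.card]
    norm_num

/-- A deterministic local strategy of one party holding its ends of `n` resource systems, each of
which is used once, one after the other. Here `I` and `O` are the input and output set of the
party's end of a resource system and `C` is the set of final outputs. The party either announces
its final output (no systems left), or feeds some `i : I` into its end of the next system and
continues in a way that depends on the output `o : O` which it receives there. -/
inductive Strategy (I O C : Type*) : ℕ → Type _
  | output (c : C) : Strategy I O C 0
  | use {n : ℕ} (i : I) (next : O → Strategy I O C n) : Strategy I O C (n + 1)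

namespace Strategy

variable {I J O P A B : Type*} [Fintype O] [Fintype P]

open Classical in
/-- The probability that the two parties announce `a` and `b` when they follow the strategies
`s` and `t` on `n` shared, independent copies of the resource system `R`. -/
noncomputable def jointProb (R : BipartiteSystem I J O P) :
    {n : ℕ} → Strategy I O A n → Strategy J P B n → A → B → ℝ
  | _, .output a', .output b', a, b => if a = a' ∧ b = b' then 1 else 0
  | _, .use i s, .use j t, a, b => ∑ o, ∑ p, R.prob i j o p * jointProb R (s o) (t p) a b

theorem jointProb_nonneg (R : BipartiteSystem I J O P) {n : ℕ} (s : Strategy I O A n)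
    (t : Strategy J P B n) (a : A) (b : B) : 0 ≤ jointProb R s t a b := by
  induction s with
  | output a' =>
    cases t with
    | output b' =>
      unfold jointProb
      split_ifs <;> norm_num
  | use i s ih =>
    cases t with
    | use j t =>
      unfold jointProb
      exact Finset.sum_nonneg fun o _ => Finset.sum_nonneg fun p _ =>
        mul_nonneg (R.prob_nonneg i j o p) (ih o (t p))

theorem sum_jointProb [Fintype A] [Fintype B] (R : BipartiteSystem I J O P) {n : ℕ}
    (s : Strategy I O A n) (t : Strategy J P B n) : ∑ a, ∑ b, jointProb R s t a b = 1 := by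
  induction s with
  | output a' =>
    cases t with
    | output b' =>
      unfold jointProb
      rw [Finset.sum_eq_single a' (fun a _ h => Finset.sum_eq_zero fun b _ => if_neg fun e => h e.1)
          (fun h => absurd (Finset.mem_univ _) h),
        Finset.sum_eq_single b' (fun b _ h => if_neg fun e => h e.2)
          (fun h => absurd (Finset.mem_univ _) h), if_pos ⟨rfl, rfl⟩]
  | use i s ih =>
    cases t with
    | use j t =>
      unfold jointProb
      have h1 : ∀ a : A, ∑ b : B, ∑ o, ∑ p, R.prob i j o p * jointProb R (s o) (t p) a b
          = ∑ o, ∑ p, R.prob i j o p * ∑ b : B, jointProb R (s o) (t p) a b := by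
        intro a
        rw [Finset.sum_comm]
        refine Finset.sum_congr rfl fun o _ => ?_
        rw [Finset.sum_comm]
        exact Finset.sum_congr rfl fun p _ => (Finset.mul_sum _ _ _).symm
      simp only [h1]
      rw [Finset.sum_comm, ← R.sum_prob i j]
      refine Finset.sum_congr rfl fun o _ => ?_
      rw [Finset.sum_comm]
      refine Finset.sum_congr rfl fun p _ => ?_
      rw [← Finset.mul_sum, ih o (t p), mul_one]

end Strategy

/-- A non-interactive protocol by which two parties with input sets `X`, `Y` and output sets
`A`, `B` use shared randomness and `n` resource systems (with input sets `I`, `J` and output sets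
`O`, `P`). The shared randomness is a finite probability space, whose outcome `r` both parties
know; each party's strategy depends only on its own input and on `r`. Private randomness is
included as a part of `r` that only one party uses. -/
structure Protocol (I J O P X Y A B : Type*) (n : ℕ) where
  Rand : Type
  [fintypeRand : Fintype Rand]
  weight : Rand → ℝ
  weight_nonneg : ∀ r, 0 ≤ weight r
  sum_weight : ∑ r, weight r = 1
  left : Rand → X → Strategy I O A n
  right : Rand → Y → Strategy J P B n

namespace Protocol

attribute [instance] Protocol.fintypeRand

variable {I J O P X Y A B : Type*} [Fintype O] [Fintype P] [Fintype A] [Fintype B]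

/-- The system which the two parties realize by running the protocol on `n` copies of the
resource system `R`. -/
noncomputable def simulated {n : ℕ} (π : Protocol I J O P X Y A B n)
    (R : BipartiteSystem I J O P) : BipartiteSystem X Y A B where
  prob x y a b := ∑ r, π.weight r * Strategy.jointProb R (π.left r x) (π.right r y) a b
  prob_nonneg x y a b := Finset.sum_nonneg fun r _ =>
    mul_nonneg (π.weight_nonneg r) (Strategy.jointProb_nonneg R _ _ a b)
  sum_prob x y := by
    have h1 : ∀ a : A, ∑ b : B, ∑ r, π.weight r *
        Strategy.jointProb R (π.left r x) (π.right r y) a b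
        = ∑ r, π.weight r * ∑ b : B, Strategy.jointProb R (π.left r x) (π.right r y) a b := by
      intro a
      rw [Finset.sum_comm]
      exact Finset.sum_congr rfl fun r _ => (Finset.mul_sum _ _ _).symm
    simp only [h1]
    rw [Finset.sum_comm, ← π.sum_weight]
    refine Finset.sum_congr rfl fun r _ => ?_
    rw [← Finset.mul_sum, Strategy.sum_jointProb, mul_one]

end Protocol

/-! Up to rounding, a non-signaling system is a pair of lists in disguise. Since the marginal of `a`
depends on `x` only, it is nearly the empirical distribution of a list `α x` of length `L`; likewise
`β y` for `b`. Prescribed joint counts compatible with both marginals are realized by permuting one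
list against the other, by some `f x y` (`exists_perm_joint_fiber_card_ge`).

It remains to share this permutation without communication: the parties need positions `g`, `h` with
`g = f x y * h`, and then read their lists at `g k` and `h k` for a common uniform `k`. In each
round shared randomness guesses `(x, y, g, h)`, and each party inputs to the box whether its own
half of the guess is right. If the guess fails, the outputs agree, so both positions or neither are
multiplied on the right by the same element, and the relation survives. If it is right, exactly one
party moves, by `g⁻¹ * f x y * h`: a move on the left establishes the relation, and the element is
`1` if the relation already held. The relation is thus absorbing, and with `N` possible guesses it
is still missing after `n` rounds with probability at most `(1 - 1/(2N))^n`
(`sum_abs_walkWeight_sub_le`). -/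

/-! ### Fibre counts, alignment by permutations, and rounding -/

open Classical in
/-- A family of finitely many prescribed multiplicities with total at most `L` is attained by the
fibres of some function on `Fin L`. -/
theorem exists_fiber_card_ge {A : Type*} [Fintype A] [Nonempty A] (m : A → ℕ) (L : ℕ)
    (h : ∑ a, m a ≤ L) :
    ∃ φ : Fin L → A, ∀ a, m a ≤ Fintype.card {i // φ i = a} := by
  obtain ⟨e⟩ : Nonempty ((Σ a, Fin (m a)) ↪ Fin L) :=
    Function.Embedding.nonempty_of_card_le (by simpa using h)
  -- The value off the range of `e` is arbitrary: extra elements only enlarge fibres, and only lower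
  -- bounds are claimed.
  refine ⟨Function.extend e Sigma.fst fun _ => Classical.arbitrary A, fun a => ?_⟩
  have := Fintype.card_le_of_injective
    (fun i : Fin (m a) => (⟨e ⟨a, i⟩, e.injective.extend_apply _ _ _⟩ :
      {i // Function.extend e Sigma.fst (fun _ => Classical.arbitrary A) i = a}))
    (fun i j hij => by simpa using hij)
  simpa using this

-- Embeddings chosen fibre by fibre glue to a single embedding because distinct fibres of `α` are
-- disjoint.
open Classical in
theorem exists_embedding_comp_eq {D I A : Type*} [Fintype D] [Fintype I] (φ : D → A) (α : I → A)
    (h : ∀ a, Fintype.card {d // φ d = a} ≤ Fintype.card {i // α i = a}) :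
    ∃ e : D ↪ I, ∀ d, α (e d) = φ d := by
  let e : ∀ a, {d // φ d = a} ↪ {i // α i = a} := fun a =>
    (Function.Embedding.nonempty_of_card_le (h a)).some
  have hα : ∀ d, α (e (φ d) ⟨d, rfl⟩) = φ d := fun d => (e (φ d) ⟨d, rfl⟩).2
  have he : ∀ a d (hd : φ d = a), (e (φ d) ⟨d, rfl⟩ : I) = e a ⟨d, hd⟩ := by
    rintro _ d rfl
    rfl
  refine ⟨⟨fun d => e (φ d) ⟨d, rfl⟩, fun d d' hh => ?_⟩, hα⟩
  have hφ : φ d = φ d' := by rw [← hα d, ← hα d']; exact congrArg α hh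
  exact congrArg Subtype.val ((e (φ d')).injective (Subtype.ext ((he _ d hφ).symm.trans hh)))

open Classical in
/-- Two functions on a finite set can be aligned by a permutation so that their joint fibres have
prescribed minimal sizes, provided that the fibres of each of them are large enough. -/
theorem exists_perm_joint_fiber_card_ge {I A B : Type*} [Fintype I] [Fintype A] [Fintype B]
    (α : I → A) (β : I → B) (m : A → B → ℕ)
    (hα : ∀ a, ∑ b, m a b ≤ Fintype.card {i // α i = a})
    (hβ : ∀ b, ∑ a, m a b ≤ Fintype.card {i // β i = b}) :
    ∃ σ : Equiv.Perm I, ∀ a b, m a b ≤ Fintype.card {i // a = α (σ i) ∧ b = β i} := by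
  -- `D` consists of the required slots, each labelled by its pair `(a, b)`. It embeds into `I` once
  -- compatibly with `α` and once with `β`; `σ` extends the partial bijection `e₂ d ↦ e₁ d`.
  let D := Σ a, Σ b, Fin (m a b)
  obtain ⟨e₁, h₁⟩ := exists_embedding_comp_eq (fun d : D => d.1) α fun a => by
    refine le_trans (Fintype.card_le_of_surjective
      (fun d : Σ b, Fin (m a b) => (⟨⟨a, d⟩, rfl⟩ : {d : D // d.1 = a})) ?_) (by simpa using hα a)
    rintro ⟨⟨a, d⟩, rfl⟩
    exact ⟨d, rfl⟩
  obtain ⟨e₂, h₂⟩ := exists_embedding_comp_eq (fun d : D => d.2.1) β fun b => by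
    refine le_trans (Fintype.card_le_of_surjective (fun d : Σ a, Fin (m a b) =>
      (⟨⟨d.1, b, d.2⟩, rfl⟩ : {d : D // d.2.1 = b})) ?_) (by simpa using hβ b)
    rintro ⟨⟨a, b, d⟩, rfl⟩
    exact ⟨⟨a, d⟩, rfl⟩
  let σ : Equiv.Perm I := ((Equiv.ofInjective e₂ e₂.injective).symm.trans
    (Equiv.ofInjective e₁ e₁.injective)).extendSubtype
  have hσ : ∀ d, σ (e₂ d) = e₁ d := fun d => by
    have : σ (e₂ d) = _ := Equiv.extendSubtype_apply_of_mem _ (e₂ d) ⟨d, rfl⟩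
    rw [this]
    have h : (⟨e₂ d, ⟨d, rfl⟩⟩ : Set.range e₂) = Equiv.ofInjective e₂ e₂.injective d := rfl
    erw [Equiv.trans_apply, h, Equiv.symm_apply_apply]
    rfl
  refine ⟨σ, fun a b => ?_⟩
  have := Fintype.card_le_of_injective
    (fun i : Fin (m a b) => (⟨e₂ ⟨a, b, i⟩, by rw [hσ, h₁], by rw [h₂]⟩ :
      {i // a = α (σ i) ∧ b = β i}))
    (fun i j hij => by simpa [D] using e₂.injective (congrArg Subtype.val hij))
  simpa using this

theorem sum_floor_mul_le {ι : Type*} [Fintype ι] (L : ℕ) (p : ι → ℝ) (hp : ∀ i, 0 ≤ p i) :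
    ∑ i, ⌊(L : ℝ) * p i⌋₊ ≤ ⌊(L : ℝ) * ∑ i, p i⌋₊ := by
  refine Nat.le_floor ?_
  rw [Nat.cast_sum, Finset.mul_sum]
  exact Finset.sum_le_sum fun i _ => Nat.floor_le (mul_nonneg (Nat.cast_nonneg _) (hp i))

/-- Natural numbers dominating the integer parts of `L` times a probability distribution, with
total `L`, are close to `L` times that distribution. -/
theorem sum_abs_sub_le_of_floor_le {ι : Type*} [Fintype ι] (p : ι → ℝ) (c : ι → ℕ) (L : ℕ)
    (hp : ∑ i, p i = 1) (hc : ∑ i, c i = L)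
    (h : ∀ i, ⌊(L : ℝ) * p i⌋₊ ≤ c i) :
    ∑ i, |(c i : ℝ) - L * p i| ≤ 2 * Fintype.card ι := by
  -- A deviation above `-1` has absolute value at most itself plus `2`. The deviations sum to zero,
  -- so only the constants remain.
  have key : ∀ i, |(c i : ℝ) - L * p i| ≤ (c i - L * p i) + 2 := fun i => by
    have h1 : (⌊(L : ℝ) * p i⌋₊ : ℝ) ≤ c i := by exact_mod_cast h i
    have h2 := Nat.lt_floor_add_one ((L : ℝ) * p i)
    rw [abs_le]
    constructor <;> linarith
  refine (Finset.sum_le_sum fun i _ => key i).trans (le_of_eq ?_)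
  rw [Finset.sum_add_distrib, Finset.sum_sub_distrib, ← Finset.mul_sum, hp, ← Nat.cast_sum, hc]
  simp [mul_comm]

/-! ### Walks steered by non-local boxes -/

theorem sum_nonLocalBox_mul (s t : ZMod 2) (F : ZMod 2 → ZMod 2 → ℝ) :
    ∑ o, ∑ p, nonLocalBox.prob s t o p * F o p
      = 1 / 2 * F 0 (s * t) + 1 / 2 * F 1 (1 + s * t) := by
  have e : ∀ o p : ZMod 2, (s * t = o + p) ↔ (o + s * t = p) := by
    generalize s * t = z
    revert z
    decide
  simp only [nonLocalBox, e, ite_mul, zero_mul, Finset.sum_ite_eq, Finset.mem_univ, if_true]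
  rw [show (Finset.univ : Finset (ZMod 2)) = {0, 1} from rfl, Finset.sum_pair (by decide)]
  simp

/-- A party walks on a group `G`. In round `w` it feeds `hit w g` into its box, where `g` is its
current position, and multiplies `g` from the right by `step w` if the box outputs `1`. In the end
it announces `out g`. -/
def walkStrategy {Ω G C : Type*} [Mul G] (hit : Ω → G → ZMod 2) (step : Ω → G) (out : G → C) :
    (n : ℕ) → (Fin n → Ω) → G → Strategy (ZMod 2) (ZMod 2) C n
  | 0, _, g => .output (out g)
  | n + 1, w, g => .use (hit (w 0) g) fun o =>
      walkStrategy hit step out n (Fin.tail w) (if o = 0 then g else g * step (w 0))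

section Walk

variable {Ω G K A B : Type*} [Mul G] [Fintype Ω] [Fintype K]
  (hit₁ hit₂ : Ω → G → ZMod 2) (step : Ω → G) (out₁ : K → G → A) (out₂ : K → G → B)

/-- The joint output weights of two walking parties, summed over all schedules of `n` rounds and
over all final shared values `k`. -/
noncomputable def walkWeight (n : ℕ) (g h : G) (a : A) (b : B) : ℝ :=
  ∑ w : Fin n → Ω, ∑ k, Strategy.jointProb nonLocalBox
    (walkStrategy hit₁ step (out₁ k) n w g) (walkStrategy hit₂ step (out₂ k) n w h) a b

open Classical in
theorem walkWeight_zero (g h : G) (a : A) (b : B) :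
    walkWeight hit₁ hit₂ step out₁ out₂ 0 g h a b
      = Fintype.card {k // a = out₁ k g ∧ b = out₂ k h} := by
  simp [walkWeight, walkStrategy, Strategy.jointProb, Fintype.card_subtype]

/-- The two terms are the box outputs `0` and `1` on the left. The right output agrees with the left
one exactly when the product of the inputs vanishes. -/
theorem walkWeight_succ (n : ℕ) (g h : G) (a : A) (b : B) :
    walkWeight hit₁ hit₂ step out₁ out₂ (n + 1) g h a b
      = ∑ w, (1 / 2 * walkWeight hit₁ hit₂ step out₁ out₂ n g
            (if hit₁ w g * hit₂ w h = 0 then h else h * step w) a b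
          + 1 / 2 * walkWeight hit₁ hit₂ step out₁ out₂ n (g * step w)
            (if hit₁ w g * hit₂ w h = 0 then h * step w else h) a b) := by
  unfold walkWeight
  rw [← (Fin.consEquiv fun _ => Ω).sum_comp, Fintype.sum_prod_type]
  refine Finset.sum_congr rfl fun w _ => ?_
  have htail : ∀ v : Fin n → Ω, Fin.tail (Fin.consEquiv (fun _ => Ω) (w, v)) = v := fun v => rfl
  simp only [Fin.consEquiv_apply, walkStrategy, Strategy.jointProb, Fin.cons_zero, htail,
    sum_nonLocalBox_mul, Finset.sum_add_distrib, ← Finset.mul_sum]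
  have hz : ∀ z : ZMod 2, (1 + z = 0) ↔ ¬ z = 0 := by decide
  simp only [if_true, one_ne_zero, if_false, hz, ite_not]

/-- If a relation between the positions is preserved by the walk, implies that the outputs are
distributed as `E`, and can be reached from everywhere in one round, then the output distribution
converges to `E` exponentially fast. -/
theorem sum_abs_walkWeight_sub_le [Fintype A] [Fintype B] (R : G → G → Prop) (E : A → B → ℕ)
    (hE : ∑ a, ∑ b, E a b = Fintype.card K)
    (h_out : ∀ g h, R g h → ∀ a b, walkWeight hit₁ hit₂ step out₁ out₂ 0 g h a b = E a b)
    (h_eq : ∀ g h w, hit₁ w g * hit₂ w h = 0 → R g h → R (g * step w) (h * step w))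
    (h_ne : ∀ g h w, hit₁ w g * hit₂ w h ≠ 0 → R g h → R g (h * step w))
    (h_ne' : ∀ g h w, hit₁ w g * hit₂ w h ≠ 0 → R (g * step w) h)
    (h_ex : ∀ g h, ∃ w, hit₁ w g * hit₂ w h ≠ 0) (n : ℕ) (g h : G) :
    (R g h → ∀ a b, walkWeight hit₁ hit₂ step out₁ out₂ n g h a b
      = (Fintype.card Ω : ℝ) ^ n * E a b) ∧
    ∑ a, ∑ b, |walkWeight hit₁ hit₂ step out₁ out₂ n g h a b - (Fintype.card Ω : ℝ) ^ n * E a b|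
      ≤ (Fintype.card Ω - 1 / 2 : ℝ) ^ n * (2 * Fintype.card K) := by
  classical
  induction n generalizing g h with
  | zero =>
    -- Both weights are non-negative with total `Fintype.card K`, whence the factor `2`.
    refine ⟨fun hR a b => by simpa using h_out g h hR a b, ?_⟩
    have hW : ∑ a, ∑ b, walkWeight hit₁ hit₂ step out₁ out₂ 0 g h a b = Fintype.card K := by
      simp only [walkWeight, Fintype.sum_unique]
      have : ∀ a : A, ∑ b : B, ∑ k, Strategy.jointProb nonLocalBox
          (walkStrategy hit₁ step (out₁ k) 0 default g)
          (walkStrategy hit₂ step (out₂ k) 0 default h) a b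
          = ∑ k, ∑ b : B, Strategy.jointProb nonLocalBox
          (walkStrategy hit₁ step (out₁ k) 0 default g)
          (walkStrategy hit₂ step (out₂ k) 0 default h) a b := fun a => Finset.sum_comm
      simp only [this]
      rw [Finset.sum_comm]
      simp [Strategy.sum_jointProb]
    have hE' : ∑ a, ∑ b, (E a b : ℝ) = Fintype.card K := by exact_mod_cast hE
    calc _ ≤ ∑ a, ∑ b, (walkWeight hit₁ hit₂ step out₁ out₂ 0 g h a b + E a b) := by
          refine Finset.sum_le_sum fun a _ => Finset.sum_le_sum fun b _ => ?_
          rw [pow_zero, one_mul, walkWeight_zero, abs_le]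
          constructor <;> linarith [(Nat.cast_nonneg (E a b) : (0 : ℝ) ≤ _),
            (Nat.cast_nonneg (Fintype.card {k // a = out₁ k g ∧ b = out₂ k h}) : (0 : ℝ) ≤ _)]
      _ = _ := by
          simp only [Finset.sum_add_distrib, hW, hE']
          ring
  | succ n ih =>
    set W := walkWeight hit₁ hit₂ step out₁ out₂ with hWdef
    set N : ℝ := (Fintype.card Ω : ℝ) with hN
    have hN1 : 1 ≤ N := by
      obtain ⟨w, -⟩ := h_ex g h
      have : Nonempty Ω := ⟨w⟩
      rw [hN]
      exact_mod_cast Fintype.card_pos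
    constructor
    · intro hR a b
      rw [hWdef, walkWeight_succ, ← hWdef]
      have : ∀ w, (1 / 2 * W n g (if hit₁ w g * hit₂ w h = 0 then h else h * step w) a b
          + 1 / 2 * W n (g * step w) (if hit₁ w g * hit₂ w h = 0 then h * step w else h) a b)
          = N ^ n * E a b := fun w => by
        split_ifs with hw
        · rw [(ih _ _).1 hR, (ih _ _).1 (h_eq g h w hw hR)]
          ring
        · rw [(ih _ _).1 (h_ne g h w hw hR), (ih _ _).1 (h_ne' g h w hw)]
          ring
      simp only [this, Finset.sum_const, Finset.card_univ, nsmul_eq_mul]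
      rw [pow_succ]
      ring
    · set T : G → G → ℝ := fun g h => ∑ a, ∑ b, |W n g h a b - N ^ n * E a b| with hT
      set Q : ℝ := (N - 1 / 2) ^ n * (2 * Fintype.card K) with hQ
      have hQ0 : 0 ≤ Q := by
        have : 0 ≤ N - 1 / 2 := by linarith
        positivity
      have hTQ : ∀ g h, T g h ≤ Q := fun g h => (ih g h).2
      have hT0 : ∀ g h, R g h → T g h = 0 := fun g h hR => by
        simp [hT, (ih g h).1 hR]
      let S₁ : Ω → G := fun w => if hit₁ w g * hit₂ w h = 0 then h else h * step w
      let S₂ : Ω → G := fun w => if hit₁ w g * hit₂ w h = 0 then h * step w else h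
      have hstep : ∀ a b, |W (n + 1) g h a b - N ^ (n + 1) * E a b|
          ≤ ∑ w, (1 / 2 * |W n g (S₁ w) a b - N ^ n * E a b|
            + 1 / 2 * |W n (g * step w) (S₂ w) a b - N ^ n * E a b|) := fun a b => by
        have : W (n + 1) g h a b - N ^ (n + 1) * E a b
            = ∑ w, (1 / 2 * (W n g (S₁ w) a b - N ^ n * E a b)
              + 1 / 2 * (W n (g * step w) (S₂ w) a b - N ^ n * E a b)) := by
          have hsum : N ^ (n + 1) * E a b = ∑ _w : Ω, N ^ n * (E a b : ℝ) := by
            simp only [Finset.sum_const, Finset.card_univ, nsmul_eq_mul]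
            rw [pow_succ]
            ring
          rw [hsum, hWdef, walkWeight_succ, ← Finset.sum_sub_distrib]
          refine Finset.sum_congr rfl fun w _ => ?_
          ring
        rw [this]
        refine (Finset.abs_sum_le_sum_abs _ _).trans (Finset.sum_le_sum fun w _ => ?_)
        refine (abs_add_le _ _).trans (le_of_eq ?_)
        simp [abs_mul]
      have hsum : ∑ a, ∑ b, |W (n + 1) g h a b - N ^ (n + 1) * E a b|
          ≤ ∑ w, (1 / 2 * T g (S₁ w) + 1 / 2 * T (g * step w) (S₂ w)) := by
        refine (Finset.sum_le_sum fun a _ => Finset.sum_le_sum fun b _ => hstep a b).trans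
          (le_of_eq ?_)
        simp only [hT, Finset.mul_sum, ← Finset.sum_add_distrib]
        rw [Finset.sum_comm]
        conv_rhs => rw [Finset.sum_comm]
        rw [Finset.sum_comm]
        refine Finset.sum_congr rfl fun a _ => ?_
        rw [Finset.sum_comm]
      obtain ⟨w₀, hw₀⟩ := h_ex g h
      -- For the correct guess `w₀`, the half in which the left party moves lands in `R` and
      -- contributes no error. This saves `Q / 2` out of `N * Q`, giving the factor `N - 1 / 2`.
      have hbound : ∀ w, 1 / 2 * T g (S₁ w) + 1 / 2 * T (g * step w) (S₂ w)
          ≤ Q - if w = w₀ then 1 / 2 * Q else 0 := fun w => by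
        split_ifs with hw
        · subst hw
          have : T (g * step w) (S₂ w) = 0 := by
            simp only [S₂, if_neg hw₀]
            exact hT0 _ _ (h_ne' g h w hw₀)
          linarith [hTQ g (S₁ w)]
        · linarith [hTQ g (S₁ w), hTQ (g * step w) (S₂ w)]
      refine hsum.trans ((Finset.sum_le_sum fun w _ => hbound w).trans (le_of_eq ?_))
      rw [Finset.sum_sub_distrib, Finset.sum_ite_eq' Finset.univ w₀]
      simp only [Finset.sum_const, Finset.card_univ, nsmul_eq_mul, Finset.mem_univ, if_true]
      rw [hQ, pow_succ]
      ring

end Walk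

/-! ### From aligned lists to the protocol -/

/-- The protocol with uniformly distributed shared randomness in a finite type of any universe. -/
noncomputable def uniformProtocol {I J O P X Y A B : Type*} (Ω : Type*) [Fintype Ω] [Nonempty Ω]
    {n : ℕ} (left : Ω → X → Strategy I O A n) (right : Ω → Y → Strategy J P B n) :
    Protocol I J O P X Y A B n where
  Rand := Fin (Fintype.card Ω)
  weight _ := (Fintype.card Ω : ℝ)⁻¹
  weight_nonneg _ := by positivity
  sum_weight := by
    have : (Fintype.card Ω : ℝ) ≠ 0 := by exact_mod_cast Fintype.card_ne_zero
    simp [this]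
  left r := left ((Fintype.equivFin Ω).symm r)
  right r := right ((Fintype.equivFin Ω).symm r)

theorem uniformProtocol_simulated_prob {I J O P X Y A B Ω : Type*} [Fintype Ω] [Nonempty Ω]
    [Fintype O] [Fintype P] [Fintype A] [Fintype B] {n : ℕ}
    (left : Ω → X → Strategy I O A n) (right : Ω → Y → Strategy J P B n)
    (R : BipartiteSystem I J O P) (x : X) (y : Y) (a : A) (b : B) :
    ((uniformProtocol Ω left right).simulated R).prob x y a b
      = (Fintype.card Ω : ℝ)⁻¹ * ∑ w, Strategy.jointProb R (left w x) (right w y) a b := by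
  rw [Finset.mul_sum]
  exact (Fintype.equivFin Ω).symm.sum_comp fun w =>
    (Fintype.card Ω : ℝ)⁻¹ * Strategy.jointProb R (left w x) (right w y) a b

open Classical in
/-- Lists of local outputs for all inputs such that, for every pair of inputs, the two lists can be
aligned by a permutation to have almost the joint statistics of the given system. -/
theorem BipartiteSystem.NonSignaling.exists_aligned_lists {X Y A B : Type*} [Fintype A] [Fintype B]
    [Nonempty X] [Nonempty Y] [Nonempty A] [Nonempty B] {S : BipartiteSystem X Y A B}
    (hS : S.NonSignaling) (L : ℕ) :
    ∃ (α : X → Fin L → A) (β : Y → Fin L → B) (f : X → Y → Equiv.Perm (Fin L)), ∀ x y a b,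
      ⌊(L : ℝ) * S.prob x y a b⌋₊ ≤ Fintype.card {i // a = α x (f x y i) ∧ b = β y i} := by
  obtain ⟨x₀⟩ := ‹Nonempty X›
  obtain ⟨y₀⟩ := ‹Nonempty Y›
  -- The reference input `y₀` makes the list depend on `x` alone; non-signaling later replaces `y₀`
  -- by the actual `y`.
  have hα : ∀ x, ∃ φ : Fin L → A, ∀ a,
      ⌊(L : ℝ) * ∑ b, S.prob x y₀ a b⌋₊ ≤ Fintype.card {i // φ i = a} := fun x =>
    exists_fiber_card_ge _ L ((sum_floor_mul_le L _ fun a =>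
      Finset.sum_nonneg fun b _ => S.prob_nonneg _ _ _ _).trans (by simp [S.sum_prob]))
  have hβ : ∀ y, ∃ φ : Fin L → B, ∀ b,
      ⌊(L : ℝ) * ∑ a, S.prob x₀ y a b⌋₊ ≤ Fintype.card {i // φ i = b} := fun y =>
    exists_fiber_card_ge _ L ((sum_floor_mul_le L _ fun b =>
      Finset.sum_nonneg fun a _ => S.prob_nonneg _ _ _ _).trans
        (by rw [Finset.sum_comm]; simp [S.sum_prob]))
  choose α hα using hα
  choose β hβ using hβ
  have hf : ∀ x y, ∃ σ : Equiv.Perm (Fin L), ∀ a b,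
      ⌊(L : ℝ) * S.prob x y a b⌋₊ ≤ Fintype.card {i // a = α x (σ i) ∧ b = β y i} := fun x y =>
    exists_perm_joint_fiber_card_ge (α x) (β y) (fun a b => ⌊(L : ℝ) * S.prob x y a b⌋₊)
      (fun a => (sum_floor_mul_le L _ fun b => S.prob_nonneg _ _ _ _).trans
        (by rw [hS.1 a x y y₀]; exact hα x a))
      (fun b => (sum_floor_mul_le L _ fun a => S.prob_nonneg _ _ _ _).trans
        (by rw [hS.2 b x x₀ y]; exact hβ y b))
  choose f hf using hf
  exact ⟨α, β, f, hf⟩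

open Classical in
/-- Parties with private inputs `x`, `y` can steer two walks on `Perm (Fin L)` towards positions
`g`, `h` with `g = f x y * h`, using one non-local box per round; reading off the entries
`α x (g k)` and `β y (h k)` at a common random place `k` then yields approximately the joint
statistics of the lists aligned by `f x y`. -/
theorem exists_protocol_tvDist_aligned_lists_le {X Y A B : Type*} [Fintype X] [Fintype Y]
    [Fintype A] [Fintype B] [Nonempty X] [Nonempty Y] {L : ℕ} (hL : 0 < L)
    (α : X → Fin L → A) (β : Y → Fin L → B) (f : X → Y → Equiv.Perm (Fin L))
    (δ : ℝ) (hδ : 0 < δ) :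
    ∃ (n : ℕ) (π : Protocol (ZMod 2) (ZMod 2) (ZMod 2) (ZMod 2) X Y A B n), ∀ x y,
      ∑ a, ∑ b, |(π.simulated nonLocalBox).prob x y a b
        - (Fintype.card {i // a = α x (f x y i) ∧ b = β y i} : ℝ) / L| ≤ δ := by
  let Ω := X × Y × Equiv.Perm (Fin L) × Equiv.Perm (Fin L)
  have : Nonempty (Fin L) := ⟨⟨0, hL⟩⟩
  have hL' : (0 : ℝ) < L := by exact_mod_cast hL
  set N : ℝ := (Fintype.card Ω : ℝ) with hN
  have hN1 : 1 ≤ N := by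
    rw [hN]
    exact_mod_cast (Fintype.card_pos : 0 < Fintype.card Ω)
  have hN0 : 0 < N := by linarith
  let hit₁ : X → Ω → Equiv.Perm (Fin L) → ZMod 2 := fun x w g => if w.1 = x ∧ w.2.2.1 = g then 1 else 0
  let hit₂ : Y → Ω → Equiv.Perm (Fin L) → ZMod 2 := fun y w h => if w.2.1 = y ∧ w.2.2.2 = h then 1 else 0
  -- Solves `g * step = f x y * h` for the guessed data.
  let step : Ω → Equiv.Perm (Fin L) := fun w => w.2.2.1⁻¹ * f w.1 w.2.1 * w.2.2.2
  have hit : ∀ x y w g h, hit₁ x w g * hit₂ y w h ≠ 0 → w = (x, y, g, h) := by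
    rintro x y ⟨x', y', g', h'⟩ g h hw
    simp only [hit₁, hit₂] at hw
    by_cases h1 : x' = x ∧ g' = g <;> by_cases h2 : y' = y ∧ h' = h <;> simp_all
  -- After normalization by `N ^ n * L` the walk bound becomes `2 * ((N - 1 / 2) / N) ^ n`.
  obtain ⟨n, hn⟩ := exists_pow_lt_of_lt_one (show 0 < δ / 2 by positivity)
    (show (N - 1 / 2) / N < 1 by rw [div_lt_one hN0]; linarith)
  refine ⟨n, uniformProtocol ((Fin n → Ω) × Fin L)
    (fun w x => walkStrategy (hit₁ x) step (fun g => α x (g w.2)) n w.1 1)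
    (fun w y => walkStrategy (hit₂ y) step (fun h => β y (h w.2)) n w.1 1), fun x y => ?_⟩
  have main := (sum_abs_walkWeight_sub_le (hit₁ x) (hit₂ y) step
    (fun k g => α x (g k)) (fun k h => β y (h k)) (fun g h => g = f x y * h)
    (fun a b => Fintype.card {i // a = α x (f x y i) ∧ b = β y i})
    (by
      simp only [Fintype.card_subtype, Finset.card_filter]
      simp_rw [ite_and]
      have : ∀ a : A, ∑ b : B, ∑ i : Fin L,
          (if a = α x (f x y i) then if b = β y i then 1 else 0 else 0)
          = ∑ i : Fin L, ∑ b : B,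
          (if a = α x (f x y i) then if b = β y i then 1 else 0 else 0) := fun a => Finset.sum_comm
      simp only [this]
      rw [Finset.sum_comm]
      simp)
    (by
      -- The substitution `i = h k` matches the places `k` with the indices `i` of the aligned
      -- lists.
      rintro _ h rfl a b
      rw [walkWeight_zero, Nat.cast_inj]
      exact Fintype.card_congr (h.subtypeEquiv fun k => by simp [Equiv.Perm.mul_apply]))
    (by rintro g h w - rfl; rw [mul_assoc])
    -- Under the relation a correct guess has `step w = 1`, so the right party's move changes
    -- nothing.
    (by
      rintro g h w hw hR
      rw [hit _ _ _ _ _ hw]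
      simp [step, hR, mul_assoc])
    (by
      rintro g h w hw
      rw [hit _ _ _ _ _ hw]
      simp [step, mul_assoc])
    (fun g h => ⟨(x, y, g, h), by simp [hit₁, hit₂]⟩) n 1 1).2
  rw [Fintype.card_fin, ← hN] at main
  set W := walkWeight (hit₁ x) (hit₂ y) step
    (fun k (g : Equiv.Perm (Fin L)) => α x (g k)) (fun k (h : Equiv.Perm (Fin L)) => β y (h k)) n 1 1 with hW
  have hterm : ∀ a b, |((uniformProtocol ((Fin n → Ω) × Fin L)
      (fun w x => walkStrategy (hit₁ x) step (fun g => α x (g w.2)) n w.1 1)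
      (fun w y => walkStrategy (hit₂ y) step (fun h => β y (h w.2)) n w.1 1)).simulated
        nonLocalBox).prob x y a b - (Fintype.card {i // a = α x (f x y i) ∧ b = β y i} : ℝ) / L|
      = (N ^ n * L)⁻¹ * |W a b
          - N ^ n * (Fintype.card {i // a = α x (f x y i) ∧ b = β y i} : ℕ)| := fun a b => by
    rw [uniformProtocol_simulated_prob, Fintype.sum_prod_type]
    have hcard : (Fintype.card ((Fin n → Ω) × Fin L) : ℝ) = N ^ n * L := by
      rw [Fintype.card_prod, Fintype.card_fun, Fintype.card_fin, Fintype.card_fin]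
      push_cast
      rfl
    have hpos : 0 < (N ^ n * L)⁻¹ := by positivity
    have habs : ∀ z, (N ^ n * L)⁻¹ * |z| = |(N ^ n * L)⁻¹ * z| := fun z => by
      rw [abs_mul, abs_of_pos hpos]
    rw [habs, hcard, mul_sub, hW, walkWeight]
    congr 2
    field_simp
  simp only [hterm, ← Finset.mul_sum]
  calc _ ≤ (N ^ n * L)⁻¹ * ((N - 1 / 2) ^ n * (2 * L)) := by gcongr
    _ = 2 * ((N - 1 / 2) / N) ^ n := by rw [div_pow]; field_simp
    _ ≤ δ := by linarith

theorem theorem1 {X Y A B : Type*} [Fintype X] [Fintype Y] [Fintype A] [Fintype B]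
    [Nonempty A] [Nonempty B] (S : BipartiteSystem X Y A B) (hS : S.NonSignaling)
    (ε : ℝ) (hε : 0 < ε) :
    ∃ (n : ℕ) (π : Protocol (ZMod 2) (ZMod 2) (ZMod 2) (ZMod 2) X Y A B n),
      ∀ x y, (π.simulated nonLocalBox).tvDist S x y ≤ ε := by
  classical
  by_cases hXY : Nonempty X ∧ Nonempty Y
  swap
  -- Without input pairs the bound is vacuous, but a protocol must still be exhibited.
  · exact ⟨0, uniformProtocol Unit (fun _ _ => .output (Classical.arbitrary A))
      (fun _ _ => .output (Classical.arbitrary B)), fun x y => absurd ⟨⟨x⟩, ⟨y⟩⟩ hXY⟩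
  obtain ⟨_, _⟩ := hXY
  -- Rounding costs at most `2 * Fintype.card (A × B) / L ≤ ε` in the `ℓ¹` distance and the walk
  -- costs another `ε`; the factor `1 / 2` in `tvDist` absorbs the sum.
  obtain ⟨L, hL⟩ := exists_nat_gt (2 * Fintype.card (A × B) / ε)
  have hL' : (0 : ℝ) < L := lt_of_le_of_lt (by positivity) hL
  obtain ⟨α, β, f, hf⟩ := hS.exists_aligned_lists L
  obtain ⟨n, π, hπ⟩ := exists_protocol_tvDist_aligned_lists_le (by exact_mod_cast hL') α β f ε hε
  refine ⟨n, π, fun x y => ?_⟩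
  have happrox := sum_abs_sub_le_of_floor_le (fun p : A × B => S.prob x y p.1 p.2)
    (fun p => Fintype.card {i // p.1 = α x (f x y i) ∧ p.2 = β y i}) L
    (by rw [Fintype.sum_prod_type]; exact S.sum_prob x y)
    (by
      simp only [Fintype.card_subtype, Finset.card_filter]
      rw [Finset.sum_comm]
      simp [← Prod.mk.injEq])
    (fun p => hf x y p.1 p.2)
  rw [Fintype.sum_prod_type] at happrox
  have hsplit : ∀ a b, |(π.simulated nonLocalBox).prob x y a b - S.prob x y a b|
      ≤ |(π.simulated nonLocalBox).prob x y a b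
          - (Fintype.card {i // a = α x (f x y i) ∧ b = β y i} : ℝ) / L|
        + (L : ℝ)⁻¹ * |(Fintype.card {i // a = α x (f x y i) ∧ b = β y i} : ℝ)
          - L * S.prob x y a b| := fun a b => by
    refine (abs_sub_le _ _ _).trans (add_le_add le_rfl (le_of_eq ?_))
    have habs : ∀ z : ℝ, (L : ℝ)⁻¹ * |z| = |(L : ℝ)⁻¹ * z| := fun z => by
      rw [abs_mul, abs_of_pos (inv_pos.2 hL')]
    rw [habs]
    congr 1
    field_simp
  have hsum := Finset.sum_le_sum fun a (_ : a ∈ Finset.univ) =>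
    Finset.sum_le_sum fun b (_ : b ∈ Finset.univ) => hsplit a b
  simp only [Finset.sum_add_distrib, ← Finset.mul_sum] at hsum
  have hsmall : (L : ℝ)⁻¹ * (2 * Fintype.card (A × B)) ≤ ε := by
    rw [inv_mul_le_iff₀ hL', mul_comm]
    rw [div_lt_iff₀ hε] at hL
    linarith
  have := mul_le_mul_of_nonneg_left happrox (inv_pos.2 hL').le
  unfold BipartiteSystem.tvDist
  linarith [hπ x y]
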